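/- For a prime $p$ let $F_p(n)$ be the number of pairs $(m,k)$ with $0\le k\le m<n$ such that $p\nmid\binom mk$. Put $A=\binom{p+1}{2}$, $\varrho_p=\log_p A$ and $$\beta_p=\liminf_{n\to\infty}\frac{F_p(n)}{n^{\varrho_p}}.$$ Let $\varphi_p:[0,1]\to\mathbb R$ be given in terms of base-$p$ expansions, with digits $b_j\in\{0,\dots,p-1\}$, by $$\varphi_p\Bigl(\sum_{j\ge1}b_jp^{-j}\Bigr)=\frac12\sum_{j\ge1}\frac{b_j}{A^j}\prod_{1\le i\le j}(b_i+1),$$ let $G_p(s)=A^{-\log_p s}\varphi_p(s)$ for $s\in[p^{-1},1]$, and let $$\hat s_p(\xi,\eta)=\frac{2\xi+1}{2p}-\frac{\eta}{p^2},\qquad B_{\xi,\eta}=G_p\bigl(\hat s_p(\xi,\eta)\bigr).$$ **Theorem.** (i) Wilson's conjecture holds: $$\beta_5=\Bigl(\frac32\Bigr)^{1-\varrho_5},\qquad \beta_7=\Bigl(\frac32\Bigr)^{1-\varrho_7},\qquad \beta_{11}=\frac{59}{44}\Bigl(\frac{22}{31}\Bigr)^{\varrho_{11}},$$ and also $\beta_3=\left(\frac32\right)^{1-\varrho_3}$.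 (ii) For every odd prime $p$ with $3\le p\le113$, $$\beta_p=B_{\xi,\eta}=\binom{\xi+1}{2}\left(1+\frac{(p-2\eta)(p-2\eta+1)}{2\xi p(p+1)}\right)\left(\frac{2\xi+1}{2}-\frac{\eta}{p}\right)^{-\varrho_p},$$ where $(\xi,\eta)$ is given by the following table: - $p\in\{3,5,7\}$: $(\xi,\eta)=(1,0)$; - $p\in\{11,13,17,19,23\}$: $(\xi,\eta)=(1,1)$; - $p=29$: $(\xi,\eta)=(2,1)$; - $p\in\{31,37,41,43,47,53\}$: $(\xi,\eta)=(2,2)$; - $p\in\{59,61,67,71,73,79\}$: $(\xi,\eta)=(2,3)$; - $p\in\{83,89,97,101,103,107\}$: $(\xi,\eta)=(2,4)$; - $p\in\{109,113\}$: $(\xi,\eta)=(2,5)$. -/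

import Mathlib

namespace PascalModPrime

/-- `F p n`: the number of pairs `(m, k)` with `0 ≤ k ≤ m < n` such that `p ∤ binom(m, k)`. -/
def F (p n : ℕ) : ℕ :=
  ∑ m ∈ Finset.range n, ((Finset.range (m + 1)).filter fun k => ¬ p ∣ m.choose k).card

/-- `A p = binom(p + 1, 2)`. -/
def A (p : ℕ) : ℕ := (p + 1).choose 2

/-- The exponent `ρ_p = log_p binom(p + 1, 2)`. -/
noncomputable def rho (p : ℕ) : ℝ := Real.logb p (A p)

/-- `β_p = liminf_{n → ∞} F_p(n) / n ^ ρ_p`. -/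
noncomputable def beta (p : ℕ) : ℝ :=
  Filter.liminf (fun n : ℕ => (F p n : ℝ) / (n : ℝ) ^ rho p) Filter.atTop

/-- The `j`-th digit (`j ≥ 1`) after the radix point in the base `p` expansion of `s ∈ [0, 1]`;
the number `1` is expanded as `0.(p-1)(p-1)(p-1)…`. -/
noncomputable def digit (p : ℕ) (s : ℝ) (j : ℕ) : ℕ :=
  if s < 1 then ⌊s * (p : ℝ) ^ j⌋₊ % p else p - 1

/-- The function `φ_p : [0, 1] → ℝ`,
`φ_p(∑_{j ≥ 1} b_j p^{-j}) = (1 / 2) ∑_{j ≥ 1} (b_j / A^j) ∏_{1 ≤ i ≤ j} (b_i + 1)`.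
The summation index below is shifted by one. -/
noncomputable def phi (p : ℕ) (s : ℝ) : ℝ :=
  (1 / 2 : ℝ) * ∑' j : ℕ, ((digit p s (j + 1) : ℝ) / (A p : ℝ) ^ (j + 1)) *
    ∏ i ∈ Finset.Icc 1 (j + 1), ((digit p s i : ℝ) + 1)

/-- `G_p(s) = A^{-log_p s} φ_p(s)` for `s ∈ [1 / p, 1]`. -/
noncomputable def G (p : ℕ) (s : ℝ) : ℝ :=
  (A p : ℝ) ^ (-Real.logb p s) * phi p s

/-- `ŝ_p(ξ, η) = (2 ξ + 1) / (2 p) - η / p ^ 2`. -/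
noncomputable def sHat (p ξ η : ℕ) : ℝ :=
  (2 * (ξ : ℝ) + 1) / (2 * (p : ℝ)) - (η : ℝ) / (p : ℝ) ^ 2

/-- `B_{ξ, η} = G_p(ŝ_p(ξ, η))`. -/
noncomputable def B (p ξ η : ℕ) : ℝ := G p (sHat p ξ η)

/-- The table of pairs `(ξ, η)` for the odd primes `3 ≤ p ≤ 113`. -/
def xiEta (p : ℕ) : ℕ × ℕ :=
  if p ∈ ({3, 5, 7} : Finset ℕ) then (1, 0)
  else if p ∈ ({11, 13, 17, 19, 23} : Finset ℕ) then (1, 1)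
  else if p ∈ ({29} : Finset ℕ) then (2, 1)
  else if p ∈ ({31, 37, 41, 43, 47, 53} : Finset ℕ) then (2, 2)
  else if p ∈ ({59, 61, 67, 71, 73, 79} : Finset ℕ) then (2, 3)
  else if p ∈ ({83, 89, 97, 101, 103, 107} : Finset ℕ) then (2, 4)
  else (2, 5)

end PascalModPrime

/-! By Lucas' theorem the number of entries prime to `p` in a row is the product of `b + 1` over the
base `p` digits `b` of its index. Summation gives `F (a p^k + n) = (a + 1) (a/2 A^k + F n)` for `a <
p`, `n ≤ p^k`. Thus `F n / A^k` is the value at `t = n / p^k` of the self-similar function `φ` with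
`φ ((b + t)/p) = (b + 1)/A · (b/2 + φ t)`, and `F n / n^ρ` depends only on `n` up to powers of `p`.

Lower bound (`Certificate.le_F`): a piecewise linear minorant of `φ` is shown to be preserved by the
recursion (`Certificate.aboveNodes_F`). Split off one or two leading digits of `n`. The required
inequality then has the form `(x t + y)^ρ ≤ α v + γ` with `v = φ t`; since `ρ ≥ 1` the left side is
convex in `t`, so it only has to hold at the four nodes. Rational bounds on `ρ` turn this into
finitely many inequalities between natural numbers. The node `(1/2, 1/4)` lies on the graph of `φ`,
and it corresponds to the minimizer `ŝ`, whose digits are `ξ, h - η, h, h, …` with `h = (p - 1)/2`;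
this is why the bound can be sharp.

Upper bound (`exists_seq_le_B`): truncating the expansion of `ŝ` gives integers along which the
quotient is at most a sequence converging to `B`. -/

namespace PascalModPrime

/-! ### Digit recursions for row counts and for `F` -/

/-- The number of entries in row `m` of Pascal's triangle that are prime to `p`. -/
def rowCount (p m : ℕ) : ℕ := ((Finset.range (m + 1)).filter fun k => ¬ p ∣ m.choose k).card

theorem F_eq_sum (p n : ℕ) : F p n = ∑ m ∈ Finset.range n, rowCount p m := rfl

theorem not_dvd_choose_of_lt {p b c : ℕ} (hp : p.Prime) (hb : b < p) (hc : c ≤ b) :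
    ¬ p ∣ b.choose c := by
  intro h
  have h1 : p ∣ b.factorial := by
    rw [← Nat.choose_mul_factorial_mul_factorial hc, mul_assoc]
    exact h.mul_right _
  exact absurd ((hp.dvd_factorial).1 h1) (by omega)

theorem dvd_choose_iff {p : ℕ} (hp : p.Prime) (m q : ℕ) {b c : ℕ} (hb : b < p) (hc : c < p) :
    p ∣ (p * m + b).choose (p * q + c) ↔ b < c ∨ p ∣ m.choose q := by
  have := Fact.mk hp
  have h := Choose.choose_modEq_choose_mod_mul_choose_div_nat
    (n := p * m + b) (k := p * q + c) (p := p)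
  rw [Nat.mul_add_mod, Nat.mul_add_mod, Nat.mod_eq_of_lt hb, Nat.mod_eq_of_lt hc,
    Nat.mul_add_div hp.pos, Nat.mul_add_div hp.pos, Nat.div_eq_of_lt hb, Nat.div_eq_of_lt hc,
    add_zero, add_zero] at h
  rw [h.dvd_iff (dvd_refl p), hp.dvd_mul]
  rcases lt_or_ge b c with hbc | hbc
  · simp [Nat.choose_eq_zero_of_lt hbc, hbc]
  · simp [not_dvd_choose_of_lt hp hb hbc, hbc.not_gt]

/-- By Lucas, `k = p q + c` gives an entry prime to `p` exactly when `c ≤ b` and `m.choose q` is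
prime to `p`; such `k` correspond to pairs `(c, q)`. -/
theorem rowCount_mul_add {p : ℕ} (hp : p.Prime) (m : ℕ) {b : ℕ} (hb : b < p) :
    rowCount p (p * m + b) = (b + 1) * rowCount p m := by
  unfold rowCount
  rw [← Finset.card_range (b + 1), ← Finset.card_product]
  symm
  refine Finset.card_nbij' (fun x => p * x.2 + x.1) (fun k => (k % p, k / p)) ?_ ?_ ?_ ?_
  · rintro ⟨c, q⟩ h
    simp only [Finset.coe_product, Set.mem_prod, Finset.mem_coe, Finset.mem_range,
      Finset.mem_filter] at h ⊢
    obtain ⟨hc, hq, hd⟩ := h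
    refine ⟨?_, ?_⟩
    · have := Nat.mul_le_mul_left p (Nat.lt_succ_iff.1 hq)
      omega
    · rw [dvd_choose_iff hp m q hb (by omega)]
      push Not
      exact ⟨by omega, hd⟩
  · intro k h
    simp only [Finset.coe_product, Set.mem_prod, Finset.mem_coe, Finset.mem_range,
      Finset.mem_filter] at h ⊢
    obtain ⟨hk, hd⟩ := h
    have hmod := Nat.mod_lt k hp.pos
    rw [← Nat.div_add_mod k p, dvd_choose_iff hp m (k / p) hb hmod] at hd
    push Not at hd
    refine ⟨by omega, ?_, hd.2⟩
    by_contra hlt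
    exact hd.2 (by rw [Nat.choose_eq_zero_of_lt (by omega)]; exact dvd_zero p)
  · rintro ⟨c, q⟩ h
    simp only [Finset.coe_product, Set.mem_prod, Finset.mem_coe, Finset.mem_range,
      Finset.mem_filter] at h
    have hc : c < p := by omega
    simp [Nat.mod_eq_of_lt hc, Nat.mul_add_div hp.pos, Nat.div_eq_of_lt hc]
  · intro k _
    exact Nat.div_add_mod k p

theorem rowCount_zero {p : ℕ} (hp : p.Prime) : rowCount p 0 = 1 := by
  simp [rowCount, Finset.filter_singleton, hp.ne_one]

/-- The factors do not depend on the position of the digit, and leading zeros of `m` contribute the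
factor 1; the induction strips last digits. -/
theorem rowCount_mul_pow_add {p : ℕ} (hp : p.Prime) {a : ℕ} (ha : a < p) (k : ℕ) :
    ∀ m < p ^ k, rowCount p (a * p ^ k + m) = (a + 1) * rowCount p m := by
  induction k with
  | zero =>
    intro m hm
    obtain rfl : m = 0 := by simpa using hm
    simpa using rowCount_mul_add hp 0 ha
  | succ k ih =>
    intro m hm
    have hb := Nat.mod_lt m hp.pos
    have hq : m / p < p ^ k := Nat.div_lt_of_lt_mul (by rwa [pow_succ'] at hm)
    have h1 : a * p ^ (k + 1) + m = p * (a * p ^ k + m / p) + m % p := by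
      conv_lhs => rw [← Nat.div_add_mod m p]
      ring
    rw [h1, rowCount_mul_add hp _ hb, ih _ hq]
    conv_rhs => rw [← Nat.div_add_mod m p, rowCount_mul_add hp _ hb]
    ring

theorem A_cast (p : ℕ) : (A p : ℝ) = p * (p + 1) / 2 := by
  rw [A, Nat.cast_choose_two]
  push_cast
  ring

theorem A_pos {p : ℕ} (hp : 0 < p) : (0 : ℝ) < A p := by
  rw [A_cast]
  positivity

theorem F_zero (p : ℕ) : F p 0 = 0 := rfl

theorem F_one {p : ℕ} (hp : p.Prime) : F p 1 = 1 := by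
  rw [F_eq_sum, Finset.sum_range_one, rowCount_zero hp]

theorem F_add_of_le {p : ℕ} (hp : p.Prime) {a : ℕ} (ha : a < p) (k : ℕ) {n : ℕ}
    (hn : n ≤ p ^ k) : F p (a * p ^ k + n) = F p (a * p ^ k) + (a + 1) * F p n := by
  simp only [F_eq_sum]
  rw [Finset.sum_range_add, Finset.mul_sum]
  congr 1
  refine Finset.sum_congr rfl fun m hm => ?_
  exact rowCount_mul_pow_add hp ha k m ((Finset.mem_range.1 hm).trans_le hn)

/-- The endpoint `a = p` is included because it yields `F (p^(k+1)) = A F (p^k)`. -/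
theorem F_mul_pow_aux {p : ℕ} (hp : p.Prime) (k : ℕ) :
    ∀ a ≤ p, (F p (a * p ^ k) : ℝ) = (a * (a + 1) / 2) * F p (p ^ k) := by
  intro a
  induction a with
  | zero => simp [F_zero]
  | succ a ih =>
    intro ha
    have h := F_add_of_le hp (show a < p by omega) k le_rfl
    have e : (a + 1) * p ^ k = a * p ^ k + p ^ k := by ring
    rw [e, h]
    push_cast
    rw [ih (by omega)]
    ring

theorem F_pow {p : ℕ} (hp : p.Prime) (k : ℕ) : (F p (p ^ k) : ℝ) = (A p : ℝ) ^ k := by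
  induction k with
  | zero => simp [F_one hp]
  | succ k ih => rw [pow_succ', F_mul_pow_aux hp k p le_rfl, ih, pow_succ', A_cast]

/-- Splitting off the leading base `p` digit. -/
theorem F_mul_pow_add {p : ℕ} (hp : p.Prime) {a : ℕ} (ha : a < p) (k : ℕ) {n : ℕ}
    (hn : n ≤ p ^ k) :
    (F p (a * p ^ k + n) : ℝ) = (a + 1) * (a / 2 * (A p : ℝ) ^ k + F p n) := by
  rw [F_add_of_le hp ha k hn]
  push_cast
  rw [F_mul_pow_aux hp k a ha.le, F_pow hp]
  ring

theorem F_mul_left {p : ℕ} (hp : p.Prime) (n : ℕ) : (F p (p * n) : ℝ) = A p * F p n := by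
  induction n with
  | zero => simp [F_zero]
  | succ n ih =>
    have h : F p (p * n + p) = F p (p * n) + ∑ b ∈ Finset.range p, (b + 1) * rowCount p n := by
      simp only [F_eq_sum]
      rw [Finset.sum_range_add]
      congr 1
      exact Finset.sum_congr rfl fun b hb => rowCount_mul_add hp n (Finset.mem_range.1 hb)
    have h2 : ((∑ b ∈ Finset.range p, (b + 1) : ℕ) : ℝ) = A p := by
      rw [A_cast]
      generalize p = q
      induction q with
      | zero => simp
      | succ q ih => rw [Finset.sum_range_succ, Nat.cast_add, ih]; push_cast; ring
    rw [mul_add, mul_one, h, ← Finset.sum_mul]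
    push_cast at h2 ⊢
    rw [ih, h2, F_eq_sum p (n + 1), Finset.sum_range_succ, ← F_eq_sum]
    push_cast
    ring

/-! ### Convex functions against a piecewise linear minorant -/

theorem le_affine_of_convexOn {f : ℝ → ℝ} {x y m q t : ℝ} {s : Set ℝ} (hf : ConvexOn ℝ s f)
    (hxs : x ∈ s) (hys : y ∈ s) (hx : f x ≤ m * x + q) (hy : f y ≤ m * y + q)
    (hxt : x ≤ t) (hty : t ≤ y) : f t ≤ m * t + q := by
  have hg : ConvexOn ℝ s fun z => f z - (m * z + q) := by
    refine hf.sub ?_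
    refine ⟨hf.1, fun a _ b _ c d _ _ hcd => ?_⟩
    simp only [smul_eq_mul]
    linear_combination q * hcd
  have h := hg.le_max_of_mem_Icc hxs hys ⟨hxt, hty⟩
  have h2 : max (f x - (m * x + q)) (f y - (m * y + q)) ≤ 0 := max_le (by linarith) (by linarith)
  linarith [h.trans h2]

/-- The point `(t, v)` lies above the piecewise linear convex function with the nodes `(0, 0)`,
`(τ, 0)`, `(1 / 2, 1 / 4)` and `(1, r)`. -/
structure AboveNodes (τ r t v : ℝ) : Prop where
  nonneg : 0 ≤ v
  left : t - τ ≤ (2 - 4 * τ) * v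
  right : 1 / 4 + (2 * r - 1 / 2) * (t - 1 / 2) ≤ v

/-- To bound a convex function of `t` by an affine function of `v` above the piecewise linear
function it suffices to do so at the nodes. -/
theorem AboveNodes.convex_le {τ r t v α γ : ℝ} (h : AboveNodes τ r t v) (ht0 : 0 ≤ t)
    (ht1 : t ≤ 1) (hτ0 : 0 ≤ τ) (hτ1 : τ < 1 / 2) (hα : 0 ≤ α) {f : ℝ → ℝ}
    (hf : ConvexOn ℝ (Set.Icc 0 1) f) (h0 : f 0 ≤ α * 0 + γ) (h1 : f τ ≤ α * 0 + γ)
    (h2 : f (1 / 2) ≤ α * (1 / 4) + γ) (h3 : f 1 ≤ α * r + γ) :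
    f t ≤ α * v + γ := by
  rcases le_total t τ with h4 | h4
  · have := le_affine_of_convexOn (m := 0) (q := γ) hf (x := 0) (y := τ) (by simp)
      ⟨hτ0, by linarith⟩ (by linarith) (by linarith) ht0 h4
    nlinarith [mul_nonneg hα h.nonneg]
  rcases le_total t (1 / 2) with h5 | h5
  · have hd : 0 < 2 - 4 * τ := by linarith
    have h6 := le_affine_of_convexOn (m := α / (2 - 4 * τ)) (q := γ - α / (2 - 4 * τ) * τ) hf
      (x := τ) (y := 1 / 2) ⟨hτ0, by linarith⟩ (by constructor <;> norm_num)
      (by linarith) (h2.trans_eq (by field_simp; ring)) h4 h5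
    have h7 : (t - τ) / (2 - 4 * τ) ≤ v := (div_le_iff₀' hd).2 h.left
    have h8 := mul_le_mul_of_nonneg_left h7 hα
    calc f t ≤ _ := h6
      _ = α * ((t - τ) / (2 - 4 * τ)) + γ := by ring
      _ ≤ _ := by linarith
  · have := le_affine_of_convexOn (m := α * (2 * r - 1 / 2))
      (q := α * (1 / 4 - (r - 1 / 4)) + γ) hf
      (x := 1 / 2) (y := 1) (by constructor <;> norm_num) (by simp)
      (by linarith) (by linarith) h5 ht1
    nlinarith [mul_le_mul_of_nonneg_left h.right hα]

theorem convexOn_affine (m q : ℝ) : ConvexOn ℝ (Set.Icc 0 1) fun t => m * t + q := by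
  refine ⟨convex_Icc 0 1, fun a _ b _ c d _ _ hcd => le_of_eq ?_⟩
  simp only [smul_eq_mul]
  linear_combination -q * hcd

/-! ### Numerical certificates -/

/-- Data for the lower bound of `F p n / n ^ rho p`: the piecewise linear function with the nodes
`(0, 0)`, `(T / (4 * m), 0)`, `(1 / 2, 1 / 4)` and `(1, R / (4 * m))` below the graph of `phi p`,
and the rational bounds `l₁ / l₂ ≤ rho p ≤ u₁ / u₂`. -/
structure Certificate where
  p : ℕ
  ξ : ℕ
  η : ℕ
  m : ℕ
  T : ℕ
  R : ℕ
  l₁ : ℕ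
  l₂ : ℕ
  u₁ : ℕ
  u₂ : ℕ

namespace Certificate

/-- The abscissa of the second node. -/
noncomputable def τ (c : Certificate) : ℝ := c.T / (4 * c.m)

/-- The value at `1` of the piecewise linear function. -/
noncomputable def r (c : Certificate) : ℝ := c.R / (4 * c.m)

/-- A condition at the four nodes. -/
def atNodes (c : Certificate) (ok : ℕ → ℕ → Bool) : Bool :=
  ok 0 0 && ok c.T 0 && ok (2 * c.m) c.m && ok (4 * c.m) c.R

/-- The inequality `α * t ≤ β * v + γ` for the points obtained from the nodes by prepending the
digit `b`. -/
def lineStep (c : Certificate) (α β γ b : ℕ) : Bool :=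
  c.atNodes fun t v => Nat.ble (α * (c.p + 1) * (b * (4 * c.m) + t))
    (β * (b + 1) * (b * (4 * c.m) + 2 * v) + γ * c.p * (c.p + 1) * (4 * c.m))

/-- Sufficient for `(x₁ / x₂) ^ rho p ≤ y₁ / y₂`. -/
def powLe (c : Certificate) (x₁ x₂ y₁ y₂ : ℕ) : Bool :=
  bif Nat.ble x₂ x₁ then Nat.ble (x₁ ^ c.u₁ * y₂ ^ c.u₂) (x₂ ^ c.u₁ * y₁ ^ c.u₂)
  else Nat.ble (x₁ ^ c.l₁ * y₂ ^ c.l₂) (x₂ ^ c.l₁ * y₁ ^ c.l₂)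

/-- The number `2 * p ^ 2 * sHat p ξ η`. -/
def base (c : Certificate) : ℕ := 2 * c.p * c.ξ + (c.p - 2 * c.η)

/-- The number `2 * p ^ 2 * (p + 1) ^ 2 * phi p (sHat p ξ η)`. -/
def height (c : Certificate) : ℕ :=
  (c.ξ + 1) * (2 * c.ξ * c.p * (c.p + 1) + (c.p - 2 * c.η) * (c.p - 2 * c.η + 1))

/-- The lower bound for numbers with leading digit `a`. -/
def coarse (c : Certificate) (a : ℕ) : Bool :=
  c.atNodes fun t v => c.powLe (2 * c.p * (a * (4 * c.m) + t)) (4 * c.m * c.base)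
    ((a + 1) * (2 * c.p * (c.p + 1) * (a * (4 * c.m) + 2 * v))) (4 * c.m * c.height)

/-- The lower bound for numbers with leading digits `a` and `b`. -/
def fine (c : Certificate) (a b : ℕ) : Bool :=
  c.atNodes fun t v =>
    c.powLe (2 * (a * c.p * (4 * c.m) + (b * (4 * c.m) + t))) (4 * c.m * c.base)
    ((a + 1) * (2 * a * c.p * (c.p + 1) * (4 * c.m) + 4 * (b + 1) * (b * (4 * c.m) + 2 * v)))
    (4 * c.m * c.height)

/-- All the finitely many inequalities needed for the lower bound. -/
def check (c : Certificate) : Bool :=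
  decide (0 < c.m ∧ 3 * c.T ≤ 4 * c.m ∧ 2 * c.m ≤ c.R ∧ c.R ≤ 4 * c.m ∧
    2 * c.η < c.p ∧ 0 < c.ξ ∧ c.ξ < c.p ∧ 0 < c.l₂ ∧ 0 < c.u₂ ∧
    c.p ^ c.l₁ ≤ (c.p * (c.p + 1) / 2) ^ c.l₂ ∧ (c.p * (c.p + 1) / 2) ^ c.u₂ ≤ c.p ^ c.u₁) &&
  (List.range c.p).all (fun b => c.lineStep (4 * c.m) (8 * c.m - 4 * c.T) c.T b &&
    c.lineStep (2 * c.R - 2 * c.m) (4 * c.m) (c.R - 2 * c.m) b) &&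
  (List.range c.p).all (fun a => Nat.beq a 0 || c.coarse a ||
    (List.range c.p).all fun b => c.fine a b)

end Certificate

/-- A certificate for each odd prime up to `113`. -/
def certificates : List Certificate := [
  ⟨3, 1, 0, 80, 51, 259, 13, 8, 31, 19⟩,
  ⟨5, 1, 0, 120, 91, 379, 5, 3, 32, 19⟩,
  ⟨7, 1, 0, 160, 131, 499, 65, 38, 12, 7⟩,
  ⟨11, 1, 1, 240, 211, 739, 33, 19, 7, 4⟩,
  ⟨13, 1, 1, 280, 251, 859, 7, 4, 30, 17⟩,
  ⟨17, 1, 1, 360, 331, 1099, 23, 13, 16, 9⟩,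
  ⟨19, 1, 1, 400, 371, 1219, 16, 9, 25, 14⟩,
  ⟨23, 1, 1, 480, 451, 1459, 43, 24, 52, 29⟩,
  ⟨29, 2, 1, 3000, 2850, 9099, 175, 97, 83, 46⟩,
  ⟨31, 2, 2, 640, 611, 1939, 56, 31, 47, 26⟩,
  ⟨37, 2, 2, 760, 731, 2299, 29, 16, 20, 11⟩,
  ⟨41, 2, 2, 840, 811, 2539, 20, 11, 31, 17⟩,
  ⟨43, 2, 2, 880, 851, 2659, 20, 11, 31, 17⟩,
  ⟨47, 2, 2, 960, 931, 2899, 31, 17, 11, 6⟩,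
  ⟨53, 2, 2, 5400, 5250, 16299, 183, 100, 97, 53⟩,
  ⟨59, 2, 3, 1200, 1171, 3619, 11, 6, 35, 19⟩,
  ⟨61, 2, 3, 1240, 1211, 3739, 11, 6, 35, 19⟩,
  ⟨67, 2, 3, 1360, 1331, 4099, 11, 6, 35, 19⟩,
  ⟨71, 2, 3, 1440, 1411, 4339, 11, 6, 35, 19⟩,
  ⟨73, 2, 3, 1480, 1451, 4459, 11, 6, 35, 19⟩,
  ⟨79, 2, 3, 1600, 1571, 4819, 142, 77, 83, 45⟩,
  ⟨83, 2, 4, 1680, 1651, 5059, 35, 19, 24, 13⟩,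
  ⟨89, 2, 4, 1800, 1771, 5419, 24, 13, 37, 20⟩,
  ⟨97, 2, 4, 1960, 1931, 5899, 37, 20, 50, 27⟩,
  ⟨101, 2, 4, 2040, 2011, 6139, 50, 27, 63, 34⟩,
  ⟨103, 2, 4, 2080, 2051, 6259, 50, 27, 63, 34⟩,
  ⟨107, 2, 4, 10800, 10650, 32499, 139, 75, 76, 41⟩,
  ⟨109, 2, 5, 2200, 2171, 6619, 89, 48, 102, 55⟩,
  ⟨113, 2, 5, 2280, 2251, 6859, 128, 69, 141, 76⟩]

set_option maxRecDepth 100000 in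
theorem check_certificates : ∀ c ∈ certificates, c.check = true := by
  decide +kernel

theorem exists_certificate {p : ℕ} (hp : p.Prime) (h3 : 3 ≤ p) (h113 : p ≤ 113) :
    ∃ c ∈ certificates, c.p = p ∧ (c.ξ, c.η) = xiEta p := by
  have : ∀ p < 114, 3 ≤ p → p.Prime →
      ∃ c ∈ certificates, c.p = p ∧ (c.ξ, c.η) = xiEta p := by
    decide +kernel
  exact this p (by omega) h3 hp

/-! ### The exponent and its rational bounds -/

theorem rpow_rho {p : ℕ} (hp : 2 ≤ p) : (p : ℝ) ^ rho p = A p :=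
  Real.rpow_logb (by positivity) (by exact_mod_cast (by omega : p ≠ 1)) (A_pos (by omega))

theorem pow_rpow_rho {p : ℕ} (hp : 2 ≤ p) (k : ℕ) : ((p : ℝ) ^ k) ^ rho p = (A p : ℝ) ^ k := by
  rw [← Real.rpow_natCast, ← Real.rpow_mul (by positivity), mul_comm, Real.rpow_mul (by positivity),
    rpow_rho hp, Real.rpow_natCast]

theorem one_le_rho {p : ℕ} (hp : 2 ≤ p) : 1 ≤ rho p := by
  have h : (2 : ℝ) ≤ p := by exact_mod_cast hp
  rw [rho, Real.le_logb_iff_rpow_le (by linarith) (A_pos (by omega)), Real.rpow_one, A_cast]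
  nlinarith

theorem A_eq_div (p : ℕ) : A p = p * (p + 1) / 2 := by
  rw [A, Nat.choose_two_right, Nat.add_sub_cancel, mul_comm]

theorem rho_le {p u₁ u₂ : ℕ} (hp : 2 ≤ p) (hu : 0 < u₂) (h : A p ^ u₂ ≤ p ^ u₁) :
    rho p ≤ u₁ / u₂ := by
  have h2 : (2 : ℝ) ≤ p := by exact_mod_cast hp
  have h' : (A p : ℝ) ^ u₂ ≤ (p : ℝ) ^ u₁ := by exact_mod_cast h
  have hu' : (0 : ℝ) < u₂ := by exact_mod_cast hu
  have hl := Real.log_le_log (pow_pos (A_pos (by omega)) _) h'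
  rw [Real.log_pow, Real.log_pow] at hl
  rw [rho, Real.logb, div_le_div_iff₀ (Real.log_pos (by linarith)) hu']
  linarith

theorem le_rho {p l₁ l₂ : ℕ} (hp : 2 ≤ p) (hl : 0 < l₂) (h : p ^ l₁ ≤ A p ^ l₂) :
    l₁ / l₂ ≤ rho p := by
  have h2 : (2 : ℝ) ≤ p := by exact_mod_cast hp
  have h' : (p : ℝ) ^ l₁ ≤ (A p : ℝ) ^ l₂ := by exact_mod_cast h
  have hl' : (0 : ℝ) < l₂ := by exact_mod_cast hl
  have hlog := Real.log_le_log (by positivity) h'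
  rw [Real.log_pow, Real.log_pow] at hlog
  rw [rho, Real.logb, div_le_div_iff₀ hl' (Real.log_pos (by linarith))]
  linarith

theorem rpow_div_le_of_pow_le {x y : ℝ} {a b : ℕ} (hb : 0 < b) (hx : 0 ≤ x) (hy : 0 ≤ y)
    (h : x ^ a ≤ y ^ b) : x ^ ((a : ℝ) / b) ≤ y := by
  refine le_of_pow_le_pow_left₀ hb.ne' hy ?_
  rwa [← Real.rpow_natCast (x ^ _), ← Real.rpow_mul hx,
    div_mul_cancel₀ _ (by exact_mod_cast hb.ne'), Real.rpow_natCast]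

/-! ### Soundness of the certificates and the lower bound -/

namespace Certificate

variable {c : Certificate}

/-- The arithmetical conditions on a certificate. -/
structure Valid (c : Certificate) : Prop where
  prime : c.p.Prime
  m_pos : 0 < c.m
  T_le : 3 * c.T ≤ 4 * c.m
  le_R : 2 * c.m ≤ c.R
  R_le : c.R ≤ 4 * c.m
  η_lt : 2 * c.η < c.p
  ξ_pos : 0 < c.ξ
  ξ_lt : c.ξ < c.p
  l₂_pos : 0 < c.l₂
  u₂_pos : 0 < c.u₂
  le_rho : (c.l₁ : ℝ) / c.l₂ ≤ rho c.p
  rho_le : rho c.p ≤ c.u₁ / c.u₂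
  line : ∀ b < c.p, c.lineStep (4 * c.m) (8 * c.m - 4 * c.T) c.T b = true ∧
    c.lineStep (2 * c.R - 2 * c.m) (4 * c.m) (c.R - 2 * c.m) b = true
  digits : ∀ a < c.p, a ≠ 0 → c.coarse a = true ∨ ∀ b < c.p, c.fine a b = true

theorem valid_of_check (hp : c.p.Prime) (h : c.check = true) : c.Valid := by
  simp only [check, Bool.and_eq_true, decide_eq_true_eq, List.all_eq_true, List.mem_range,
    Bool.or_eq_true, Nat.beq_eq] at h
  obtain ⟨⟨⟨h1, h2, h3, h4, h5, h6, h7, h8, h9, h10, h11⟩, h12⟩, h13⟩ := h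
  rw [← A_eq_div] at h10 h11
  refine ⟨hp, h1, h2, h3, h4, h5, h6, h7, h8, h9, PascalModPrime.le_rho hp.two_le h8 h10,
    PascalModPrime.rho_le hp.two_le h9 h11, h12, fun a ha ha0 => ?_⟩
  have := h13 a ha
  tauto

theorem convex_le_of_atNodes (hc : c.Valid) {ok : ℕ → ℕ → Bool}
    (hok : c.atNodes ok = true) {t v α γ : ℝ} {f : ℝ → ℝ}
    (hsound : ∀ x y : ℕ, ok x y = true → f (x / (4 * c.m)) ≤ α * (y / (4 * c.m)) + γ)
    (h : AboveNodes c.τ c.r t v) (ht0 : 0 ≤ t) (ht1 : t ≤ 1) (hα : 0 ≤ α)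
    (hf : ConvexOn ℝ (Set.Icc 0 1) f) : f t ≤ α * v + γ := by
  simp only [atNodes, Bool.and_eq_true] at hok
  obtain ⟨⟨⟨h0, h1⟩, h2⟩, h3⟩ := hok
  have hm : (0 : ℝ) < c.m := by exact_mod_cast hc.m_pos
  have hT : 3 * (c.T : ℝ) ≤ 4 * c.m := by exact_mod_cast hc.T_le
  refine h.convex_le ht0 ht1 (by unfold τ; positivity) ?_ hα hf ?_ ?_ ?_ ?_
  · rw [τ, div_lt_iff₀ (by positivity)]
    linarith
  · simpa using hsound _ _ h0
  · simpa [τ] using hsound _ _ h1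
  · have := hsound _ _ h2
    push_cast at this
    rwa [show 2 * (c.m : ℝ) / (4 * c.m) = 1 / 2 by field_simp; norm_num,
      show (c.m : ℝ) / (4 * c.m) = 1 / 4 by field_simp] at this
  · have := hsound _ _ h3
    push_cast at this
    rwa [div_self (by positivity)] at this

/-- After multiplication by `p (p + 1)` both sides are affine, in `t` and in `v` respectively, and
the coefficient of `v` is nonnegative, so the nodes decide. -/
theorem lineStep_sound (hc : c.Valid) {α β γ b : ℕ} (h : c.lineStep α β γ b = true) {t v : ℝ}
    (ht0 : 0 ≤ t) (ht1 : t ≤ 1) (hv : AboveNodes c.τ c.r t v) :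
    α * ((b + t) / c.p) ≤ β * (2 * (b + 1) / (c.p * (c.p + 1)) * (b / 2 + v)) + γ := by
  have hp : (0 : ℝ) < c.p := by exact_mod_cast hc.prime.pos
  have hm : (0 : ℝ) < c.m := by exact_mod_cast hc.m_pos
  have key := convex_le_of_atNodes hc h
    (f := fun t => (α * (c.p + 1) : ℝ) * t + α * (c.p + 1) * b) (α := 2 * β * (b + 1))
    (γ := β * (b + 1) * b + γ * c.p * (c.p + 1)) (t := t) (v := v) ?_ hv ht0 ht1 (by positivity)
    (convexOn_affine _ _)
  · have e1 : α * ((b + t) / c.p)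
        = ((α * (c.p + 1) : ℝ) * t + α * (c.p + 1) * b) / (c.p * (c.p + 1)) := by
      field_simp
      ring
    have e2 : β * (2 * (b + 1) / (c.p * (c.p + 1)) * (b / 2 + v)) + γ
        = (2 * β * (b + 1) * v + (β * (b + 1) * b + γ * c.p * (c.p + 1)))
          / (c.p * (c.p + 1)) := by
      field_simp
      ring
    rw [e1, e2]
    gcongr
  · intro x y hxy
    have hxy' := (Nat.cast_le (α := ℝ)).2 (Nat.le_of_ble_eq_true hxy)
    push_cast at hxy'
    have e1 : (α * (c.p + 1) : ℝ) * (x / (4 * c.m)) + α * (c.p + 1) * b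
        = (α * (c.p + 1) * (b * (4 * c.m) + x)) / (4 * c.m) := by
      field_simp
      ring
    have e2 : 2 * β * (b + 1) * (y / (4 * c.m) : ℝ) + (β * (b + 1) * b + γ * c.p * (c.p + 1))
        = (β * (b + 1) * (b * (4 * c.m) + 2 * y) + γ * c.p * (c.p + 1) * (4 * c.m))
          / (4 * c.m) := by
      field_simp
      ring
    simp only [e1, e2]
    gcongr

/-- The exponent is replaced by its upper bound when the base is at least 1 and by its lower bound
otherwise; either replacement only increases the power. -/
theorem powLe_sound (hc : c.Valid) {x₁ x₂ y₁ y₂ : ℕ} (h : c.powLe x₁ x₂ y₁ y₂ = true)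
    (hx₂ : 0 < x₂) (hy₂ : 0 < y₂) : ((x₁ : ℝ) / x₂) ^ rho c.p ≤ y₁ / y₂ := by
  have hx₂' : (0 : ℝ) < x₂ := by exact_mod_cast hx₂
  have hy₂' : (0 : ℝ) < y₂ := by exact_mod_cast hy₂
  have cross : ∀ {a b : ℕ}, x₁ ^ a * y₂ ^ b ≤ x₂ ^ a * y₁ ^ b →
      ((x₁ : ℝ) / x₂) ^ a ≤ ((y₁ : ℝ) / y₂) ^ b := by
    intro a b hab
    rw [div_pow, div_pow, div_le_div_iff₀ (by positivity) (by positivity)]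
    rw [mul_comm (x₂ ^ a)] at hab
    exact_mod_cast hab
  have hρ := one_le_rho hc.prime.two_le
  rcases Nat.eq_zero_or_pos x₁ with rfl | hx₁
  · rw [Nat.cast_zero, zero_div, Real.zero_rpow (by linarith)]
    positivity
  have hx₁' : (0 : ℝ) < x₁ := by exact_mod_cast hx₁
  unfold powLe at h
  cases hble : Nat.ble x₂ x₁ with
  | true =>
    rw [hble, cond_true] at h
    have hle : (x₂ : ℝ) ≤ x₁ := by exact_mod_cast Nat.le_of_ble_eq_true hble
    refine (Real.rpow_le_rpow_of_exponent_le ?_ hc.rho_le).trans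
      (rpow_div_le_of_pow_le hc.u₂_pos (by positivity) (by positivity)
        (cross (Nat.le_of_ble_eq_true h)))
    rwa [le_div_iff₀ hx₂', one_mul]
  | false =>
    rw [hble, cond_false] at h
    have hle : (x₁ : ℝ) ≤ x₂ := by
      have : ¬ x₂ ≤ x₁ := fun hh => by simp [Nat.ble_eq_true_of_le hh] at hble
      exact_mod_cast (by omega : x₁ ≤ x₂)
    refine (Real.rpow_le_rpow_of_exponent_ge (by positivity) ?_ hc.le_rho).trans
      (rpow_div_le_of_pow_le hc.l₂_pos (by positivity) (by positivity)
        (cross (Nat.le_of_ble_eq_true h)))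
    rwa [div_le_iff₀ hx₂', one_mul]

theorem base_pos (hc : c.Valid) : 0 < c.base := by
  have := hc.η_lt
  unfold base
  omega

theorem height_pos (hc : c.Valid) : 0 < c.height := by
  have := hc.η_lt
  unfold height
  have : 0 < c.p - 2 * c.η := by omega
  positivity

theorem convexOn_rpow_affine {ρ x y : ℝ} (hρ : 1 ≤ ρ) (hx : 0 ≤ x) (hy : 0 ≤ y) :
    ConvexOn ℝ (Set.Icc 0 1) fun t => (x * t + y) ^ ρ := by
  refine ⟨convex_Icc 0 1, fun s hs t ht a b ha hb hab => ?_⟩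
  have h := (convexOn_rpow hρ).2 (x := x * s + y) (y := x * t + y)
    (Set.mem_Ici.2 (add_nonneg (mul_nonneg hx hs.1) hy))
    (Set.mem_Ici.2 (add_nonneg (mul_nonneg hx ht.1) hy)) ha hb hab
  simp only [smul_eq_mul] at h ⊢
  refine le_of_eq_of_le ?_ h
  congr 1
  linear_combination -y * hab

theorem coarse_sound (hc : c.Valid) {a : ℕ} (h : c.coarse a = true) {t v : ℝ}
    (ht0 : 0 ≤ t) (ht1 : t ≤ 1) (hv : AboveNodes c.τ c.r t v) :
    (2 * c.p * (a + t) / c.base) ^ rho c.p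
      ≤ 4 * c.p * (c.p + 1) * ((a + 1) * (a / 2 + v)) / c.height := by
  have hp : (0 : ℝ) < c.p := by exact_mod_cast hc.prime.pos
  have hm : (0 : ℝ) < c.m := by exact_mod_cast hc.m_pos
  have hb : (0 : ℝ) < c.base := by exact_mod_cast base_pos hc
  have hh : (0 : ℝ) < c.height := by exact_mod_cast height_pos hc
  have key := convex_le_of_atNodes hc h
    (f := fun t => (2 * c.p / c.base * t + 2 * c.p * a / c.base) ^ rho c.p)
    (α := 4 * c.p * (c.p + 1) * (a + 1) / c.height)
    (γ := 2 * c.p * (c.p + 1) * (a + 1) * a / c.height) (t := t) (v := v) ?_ hv ht0 ht1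
    (by positivity)
    (convexOn_rpow_affine (one_le_rho hc.prime.two_le) (by positivity) (by positivity))
  · convert key using 1
    · congr 1
      field_simp
      ring
    · field_simp
      ring
  · intro x y hxy
    have := powLe_sound hc hxy (Nat.mul_pos (by have := hc.m_pos; omega) (base_pos hc))
      (Nat.mul_pos (by have := hc.m_pos; omega) (height_pos hc))
    push_cast at this
    convert this using 1
    · congr 1
      field_simp
      ring
    · field_simp
      ring

theorem fine_sound (hc : c.Valid) {a b : ℕ} (h : c.fine a b = true) {t v : ℝ}
    (ht0 : 0 ≤ t) (ht1 : t ≤ 1) (hv : AboveNodes c.τ c.r t v) :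
    (2 * c.p * (a + (b + t) / c.p) / c.base) ^ rho c.p ≤ 4 * c.p * (c.p + 1) *
      ((a + 1) * (a / 2 + 2 * (b + 1) / (c.p * (c.p + 1)) * (b / 2 + v))) / c.height := by
  have hp : (0 : ℝ) < c.p := by exact_mod_cast hc.prime.pos
  have hm : (0 : ℝ) < c.m := by exact_mod_cast hc.m_pos
  have hb : (0 : ℝ) < c.base := by exact_mod_cast base_pos hc
  have hh : (0 : ℝ) < c.height := by exact_mod_cast height_pos hc
  have key := convex_le_of_atNodes hc h
    (f := fun t => (2 / c.base * t + 2 * (c.p * a + b) / c.base) ^ rho c.p)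
    (α := 8 * (a + 1) * (b + 1) / c.height)
    (γ := (a + 1) * (2 * a * c.p * (c.p + 1) + 4 * (b + 1) * b) / c.height)
    (t := t) (v := v) ?_ hv ht0 ht1
    (by positivity)
    (convexOn_rpow_affine (one_le_rho hc.prime.two_le) (by positivity) (by positivity))
  · convert key using 1
    · congr 1
      field_simp
      ring
    · field_simp
      ring
  · intro x y hxy
    have := powLe_sound hc hxy (Nat.mul_pos (by have := hc.m_pos; omega) (base_pos hc))
      (Nat.mul_pos (by have := hc.m_pos; omega) (height_pos hc))
    push_cast at this
    convert this using 1
    · congr 1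
      field_simp
      ring
    · field_simp
      ring

/-- The two line hypotheses are the last two conditions of `AboveNodes` multiplied by `4 m`. The
bounds on `T` and `R` keep the natural subtractions from truncating. -/
theorem aboveNodes_of_lines (hc : c.Valid) {t v : ℝ} (hv : 0 ≤ v)
    (hl : ((4 * c.m : ℕ) : ℝ) * t ≤ ((8 * c.m - 4 * c.T : ℕ) : ℝ) * v + c.T)
    (hr : ((2 * c.R - 2 * c.m : ℕ) : ℝ) * t ≤ ((4 * c.m : ℕ) : ℝ) * v + (c.R - 2 * c.m : ℕ)) :
    AboveNodes c.τ c.r t v := by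
  have hm : (0 : ℝ) < c.m := by exact_mod_cast hc.m_pos
  have h1 := hc.T_le
  have h2 := hc.le_R
  push_cast [Nat.cast_sub (show 4 * c.T ≤ 8 * c.m by omega),
    Nat.cast_sub (show 2 * c.m ≤ 2 * c.R by omega), Nat.cast_sub h2] at hl hr
  refine ⟨hv, ?_, ?_⟩
  · rw [τ, ← sub_nonneg]
    have : 0 ≤ ((8 * c.m - 4 * c.T) * v + c.T - 4 * c.m * t) / (4 * c.m) :=
      div_nonneg (by linarith) (by positivity)
    convert this using 1
    field_simp
    ring
  · rw [r, ← sub_nonneg]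
    have : 0 ≤ (4 * c.m * v + (c.R - 2 * c.m) - (2 * c.R - 2 * c.m) * t) / (4 * c.m) :=
      div_nonneg (by linarith) (by positivity)
    convert this using 1
    field_simp
    ring

theorem aboveNodes_F (hc : c.Valid) (k : ℕ) :
    ∀ n ≤ c.p ^ k, AboveNodes c.τ c.r ((n : ℝ) / c.p ^ k) (F c.p n / (A c.p : ℝ) ^ k) := by
  have hp := hc.prime
  have hp0 : (0 : ℝ) < c.p := by exact_mod_cast hp.pos
  have hA := A_pos hp.pos
  have h1 := hc.T_le
  have h2 := hc.le_R
  have h3 := hc.R_le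
  induction k with
  | zero =>
    intro n hn
    rw [pow_zero] at hn
    have h1' : 3 * (c.T : ℝ) ≤ 4 * c.m := by exact_mod_cast h1
    have h3' : (c.R : ℝ) ≤ 4 * c.m := by exact_mod_cast h3
    -- At `t = v = 1` the two lines require exactly `3 T ≤ 4 m` and `R ≤ 4 m`.
    interval_cases n
    · refine aboveNodes_of_lines hc ?_ ?_ ?_ <;> simp [F_zero]
    · refine aboveNodes_of_lines hc ?_ ?_ ?_
      · simp [F_one hp]
      · push_cast [Nat.cast_sub (show 4 * c.T ≤ 8 * c.m by omega), F_one hp]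
        norm_num
        linarith
      · push_cast [Nat.cast_sub (show 2 * c.m ≤ 2 * c.R by omega), Nat.cast_sub h2, F_one hp]
        norm_num
        linarith
  | succ k ih =>
    intro n hn
    obtain ⟨b, hb, n', hn', rfl⟩ : ∃ b < c.p, ∃ n' ≤ c.p ^ k, n = b * c.p ^ k + n' := by
      rcases hn.lt_or_eq with hlt | rfl
      · refine ⟨n / c.p ^ k, Nat.div_lt_of_lt_mul (by rwa [← pow_succ]), n % c.p ^ k,
          (Nat.mod_lt _ (pow_pos hp.pos k)).le, ?_⟩
        rw [mul_comm]
        exact (Nat.div_add_mod n _).symm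
      -- The endpoint `p^(k+1)` is treated as `(p - 1) p^k + p^k`, which is why `n' = p^k` is
      -- admitted.
      · refine ⟨c.p - 1, Nat.sub_lt hp.pos one_pos, c.p ^ k, le_rfl, ?_⟩
        rw [← Nat.succ_mul, pow_succ', Nat.succ_eq_add_one, Nat.sub_add_cancel hp.one_le]
    have hv := ih n' hn'
    have ht1 : (n' : ℝ) / c.p ^ k ≤ 1 := by
      rw [div_le_one (by positivity)]
      exact_mod_cast hn'
    have e1 : ((b * c.p ^ k + n' : ℕ) : ℝ) / c.p ^ (k + 1) = (b + n' / c.p ^ k) / c.p := by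
      push_cast
      rw [pow_succ]
      field_simp
    have e2 : (F c.p (b * c.p ^ k + n') : ℝ) / (A c.p : ℝ) ^ (k + 1)
        = 2 * (b + 1) / (c.p * (c.p + 1)) * (b / 2 + F c.p n' / (A c.p : ℝ) ^ k) := by
      rw [F_mul_pow_add hp hb k hn', pow_succ]
      have : 2 * ((b : ℝ) + 1) / (c.p * (c.p + 1)) = (b + 1) / A c.p := by
        rw [A_cast]
        field_simp
      rw [this]
      field_simp
    rw [e1, e2]
    have hl := hc.line b hb
    exact aboveNodes_of_lines hc (by have := hv.nonneg; positivity)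
      (lineStep_sound hc hl.1 (by positivity) ht1 hv)
      (lineStep_sound hc hl.2 (by positivity) ht1 hv)

/-- The lower bound for `F p n / n ^ rho p`. -/
theorem le_F (hc : c.Valid) {n : ℕ} (hn : 0 < n) :
    c.height / (4 * c.p * (c.p + 1)) * ((c.base : ℝ) / (2 * c.p)) ^ (-rho c.p)
      ≤ F c.p n / (n : ℝ) ^ rho c.p := by
  have hp := hc.prime
  have hp0 : (0 : ℝ) < c.p := by exact_mod_cast hp.pos
  have hA := A_pos hp.pos
  have hb : (0 : ℝ) < c.base := by exact_mod_cast base_pos hc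
  have hh : (0 : ℝ) < c.height := by exact_mod_cast height_pos hc
  have hn0 : (0 : ℝ) < n := by exact_mod_cast hn
  obtain ⟨k, a, ha, ha0, n', hn', hnn⟩ :
      ∃ k, ∃ a < c.p, a ≠ 0 ∧ ∃ n' < c.p ^ k, n = a * c.p ^ k + n' := by
    refine ⟨Nat.log c.p n, n / c.p ^ Nat.log c.p n, ?_, ?_, n % c.p ^ Nat.log c.p n,
      Nat.mod_lt _ (pow_pos hp.pos _), ?_⟩
    · exact Nat.div_lt_of_lt_mul (by
        rw [← pow_succ]; exact Nat.lt_pow_succ_log_self hp.one_lt n)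
    · exact (Nat.div_pos (Nat.pow_log_le_self _ hn.ne') (pow_pos hp.pos _)).ne'
    · rw [mul_comm]
      exact (Nat.div_add_mod n _).symm
  have key : (2 * c.p * (a + n' / c.p ^ k) / c.base : ℝ) ^ rho c.p ≤ 4 * c.p * (c.p + 1) *
      ((a + 1) * (a / 2 + F c.p n' / (A c.p : ℝ) ^ k)) / c.height := by
    rcases hc.digits a ha ha0 with h | h
    · refine coarse_sound hc h (by positivity) ?_ (aboveNodes_F hc k n' hn'.le)
      rw [div_le_one (by positivity)]
      exact_mod_cast hn'.le
    -- Dividing `p n'` rather than `n'` by `p^k` gives the second digit `b` even when `k = 0`; the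
    -- extra factor `p` is undone by `F_mul_left`.
    · have hlt : c.p * n' < c.p ^ k * c.p := by
        rw [mul_comm]
        exact Nat.mul_lt_mul_of_pos_right hn' hp.pos
      set b := c.p * n' / c.p ^ k with hb_def
      set n'' := c.p * n' % c.p ^ k with hn_def
      have hb_lt : b < c.p := Nat.div_lt_of_lt_mul hlt
      have hn'' : n'' < c.p ^ k := Nat.mod_lt _ (pow_pos hp.pos _)
      have e : c.p * n' = b * c.p ^ k + n'' := by
        rw [mul_comm b]
        exact (Nat.div_add_mod _ _).symm
      have e' : (c.p : ℝ) * n' = b * c.p ^ k + n'' := by exact_mod_cast e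
      have hF : (A c.p : ℝ) * F c.p n' = (b + 1) * (b / 2 * (A c.p : ℝ) ^ k + F c.p n'') := by
        rw [← F_mul_left hp, e, F_mul_pow_add hp hb_lt k hn''.le]
      have ht : (n' : ℝ) / c.p ^ k = (b + n'' / c.p ^ k) / c.p := by
        field_simp
        linarith
      have hv : F c.p n' / (A c.p : ℝ) ^ k
          = 2 * (b + 1) / (c.p * (c.p + 1)) * (b / 2 + F c.p n'' / (A c.p : ℝ) ^ k) := by
        have : 2 * ((b : ℝ) + 1) / (c.p * (c.p + 1)) = (b + 1) / A c.p := by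
          rw [A_cast]
          field_simp
        rw [this]
        field_simp
        linarith
      rw [ht, hv]
      refine fine_sound hc (h b hb_lt) (by positivity) ?_ (aboveNodes_F hc k n'' hn''.le)
      rw [div_le_one (by positivity)]
      exact_mod_cast hn''.le
  have hFn : (F c.p n : ℝ) = (A c.p : ℝ) ^ k *
      ((a + 1) * (a / 2 + F c.p n' / (A c.p : ℝ) ^ k)) := by
    rw [hnn, F_mul_pow_add hp ha k hn'.le]
    field_simp
  -- Here `base / (2 p)` is `p ŝ`, and the last factor compares `a + t` with it.
  have hn_eq : (n : ℝ) = c.p ^ k * ((c.base / (2 * c.p)) *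
      (2 * c.p * (a + n' / c.p ^ k) / c.base)) := by
    rw [hnn]
    push_cast
    field_simp
  have hnpow : (n : ℝ) ^ rho c.p = (A c.p : ℝ) ^ k * ((c.base / (2 * c.p) : ℝ) ^ rho c.p *
      (2 * c.p * (a + n' / c.p ^ k) / c.base : ℝ) ^ rho c.p) := by
    rw [hn_eq, Real.mul_rpow (by positivity) (by positivity),
      Real.mul_rpow (by positivity) (by positivity), pow_rpow_rho hp.two_le]
  have hu : (0 : ℝ) < (c.base / (2 * c.p) : ℝ) ^ rho c.p := by positivity
  rw [le_div_iff₀ (by positivity), hnpow, hFn, Real.rpow_neg (by positivity)]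
  rw [le_div_iff₀ hh] at key
  set X := (2 * c.p * (a + n' / c.p ^ k) / c.base : ℝ) ^ rho c.p
  calc _ = (A c.p : ℝ) ^ k * (X * c.height / (4 * c.p * (c.p + 1))) := by
        field_simp
    _ ≤ _ := by
        gcongr
        rw [div_le_iff₀ (by positivity)]
        linarith

end Certificate

/-! ### The point `ŝ` and the upper bound -/

section

variable {p ξ η h : ℕ}

/-- The natural number with `k` base `p` digits all equal to `(p - 1) / 2`. -/
def halfPow (p k : ℕ) : ℕ := (p ^ k - 1) / 2

theorem two_mul_halfPow (hp : p = 2 * h + 1) (k : ℕ) : 2 * halfPow p k + 1 = p ^ k := by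
  obtain ⟨r, hr⟩ : Odd (p ^ k) := Odd.pow ⟨h, hp⟩
  unfold halfPow
  omega

theorem halfPow_succ (hp : p = 2 * h + 1) (k : ℕ) :
    halfPow p (k + 1) = p * halfPow p k + h := by
  have h1 := two_mul_halfPow hp k
  have h2 := two_mul_halfPow hp (k + 1)
  rw [pow_succ', ← h1] at h2
  nlinarith

theorem halfPow_succ' (hp : p = 2 * h + 1) (k : ℕ) :
    halfPow p (k + 1) = h * p ^ k + halfPow p k := by
  rw [halfPow_succ hp, ← two_mul_halfPow hp k, hp]
  ring

theorem halfPow_lt (hp : p = 2 * h + 1) (k : ℕ) : halfPow p k < p ^ k := by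
  have := two_mul_halfPow hp k
  omega

/-- Since `A = (h + 1) (2 h + 1)`, the value `1/4` is fixed by prepending the digit `h`: `(h + 1)
(h/2 + 1/4) = A/4`. -/
theorem F_halfPow_le (hprime : p.Prime) (hp : p = 2 * h + 1) (k : ℕ) :
    (F p (halfPow p k) : ℝ) ≤ (A p : ℝ) ^ k / 4 := by
  induction k with
  | zero => simp [halfPow, F_zero]
  | succ k ih =>
    rw [halfPow_succ' hp, F_mul_pow_add hprime (by omega) k (halfPow_lt hp k).le, pow_succ]
    have e : (A p : ℝ) = (h + 1) * (2 * h + 1) := by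
      rw [A_cast, hp]
      push_cast
      ring
    have : ((h : ℝ) + 1) * (h / 2 * (A p : ℝ) ^ k + F p (halfPow p k))
        ≤ (h + 1) * (h / 2 * (A p : ℝ) ^ k + (A p : ℝ) ^ k / 4) := by gcongr
    refine this.trans_eq ?_
    linear_combination (-(A p : ℝ) ^ k / 4) * e

/-- The integer part of `p ^ (k + 2) * sHat p ξ η`. -/
def approx (p ξ η h k : ℕ) : ℕ := ξ * p ^ (k + 1) + ((h - η) * p ^ k + halfPow p k)

/-- The part cut off has all digits equal to `h`, and `0.hhh… = 1/2`. -/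
theorem approx_cast (hp : p = 2 * h + 1) (hη : η ≤ h) (k : ℕ) :
    sHat p ξ η * (p : ℝ) ^ (k + 2) = approx p ξ η h k + 1 / 2 := by
  have h1 : (2 * halfPow p k + 1 : ℝ) = (p : ℝ) ^ k := by exact_mod_cast two_mul_halfPow hp k
  have h2 : (p : ℝ) = 2 * h + 1 := by exact_mod_cast hp
  have h3 : (halfPow p k : ℝ) = ((p : ℝ) ^ k - 1) / 2 := by linarith
  have h4 : (p : ℝ) ≠ 0 := by rw [h2]; positivity
  have h5 : (h : ℝ) = (p - 1) / 2 := by linarith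
  rw [approx, sHat]
  push_cast [Nat.cast_sub hη]
  rw [h3, h5]
  field_simp
  ring

theorem sHat_pos (hp : p = 2 * h + 1) (hη : η ≤ h) : 0 < sHat p ξ η := by
  have h1 := approx_cast (ξ := ξ) hp hη 0
  have h2 : (0 : ℝ) < (p : ℝ) ^ (0 + 2) := pow_pos (by rw [hp]; positivity) _
  have h3 : 0 < sHat p ξ η * (p : ℝ) ^ (0 + 2) := by
    rw [h1]
    positivity
  exact pos_of_mul_pos_left h3 h2.le

theorem floor_sHat (hp : p = 2 * h + 1) (hη : η ≤ h) (k : ℕ) :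
    ⌊sHat p ξ η * (p : ℝ) ^ (k + 2)⌋₊ = approx p ξ η h k := by
  rw [approx_cast hp hη, Nat.floor_eq_iff (by positivity)]
  constructor <;> linarith

theorem sHat_lt_one (hp : p = 2 * h + 1) (hη : η ≤ h) (hξ : ξ < p) : sHat p ξ η < 1 := by
  have h1 := approx_cast (ξ := ξ) hp hη 0
  have h2 : (0 : ℝ) < (p : ℝ) ^ (0 + 2) := pow_pos (by rw [hp]; positivity) _
  have h3 : (approx p ξ η h 0 : ℝ) + 1 ≤ (p : ℝ) ^ (0 + 2) := by
    have : approx p ξ η h 0 + 1 ≤ p ^ 2 := by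
      have : ξ * p + p ≤ p * p := by
        rw [← Nat.succ_mul]
        exact Nat.mul_le_mul_right p hξ
      simp only [approx, halfPow, zero_add, pow_zero, pow_one, sq]
      omega
    exact_mod_cast this
  by_contra! h4
  have h5 := mul_le_mul_of_nonneg_right h4 h2.le
  rw [h1, one_mul] at h5
  have h6 := h3.trans h5
  norm_num at h6

theorem digit_sHat_one (hp : p = 2 * h + 1) (hη : η ≤ h) (hξ : ξ < p) :
    digit p (sHat p ξ η) 1 = ξ := by
  have h2 : (p : ℝ) = 2 * h + 1 := by exact_mod_cast hp
  have h0 : (0 : ℝ) < p := by rw [h2]; positivity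
  have h3 : (η : ℝ) ≤ h := by exact_mod_cast hη
  have e : sHat p ξ η * (p : ℝ) ^ 1 = ξ + (p - 2 * η) / (2 * p) := by
    rw [sHat]
    field_simp
    ring
  have : ⌊sHat p ξ η * (p : ℝ) ^ 1⌋₊ = ξ := by
    have h5 : (0 : ℝ) ≤ (p - 2 * η) / (2 * p) := div_nonneg (by linarith) (by positivity)
    have h6 : ((p : ℝ) - 2 * η) / (2 * p) < 1 := by
      rw [div_lt_one (by positivity)]
      linarith [Nat.cast_nonneg (α := ℝ) η]
    rw [e, Nat.floor_eq_iff (by positivity)]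
    constructor <;> linarith
  rw [digit, if_pos (sHat_lt_one hp hη hξ), this, Nat.mod_eq_of_lt hξ]

theorem digit_sHat_two (hp : p = 2 * h + 1) (hη : η ≤ h) (hξ : ξ < p) :
    digit p (sHat p ξ η) 2 = h - η := by
  have h1 := floor_sHat (ξ := ξ) hp hη 0
  rw [zero_add] at h1
  rw [digit, if_pos (sHat_lt_one hp hη hξ), h1]
  simp only [approx, halfPow, zero_add, pow_zero, pow_one]
  norm_num
  exact Nat.mod_eq_of_lt (by omega)

theorem digit_sHat_add_three (hp : p = 2 * h + 1) (hη : η ≤ h) (hξ : ξ < p) (k : ℕ) :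
    digit p (sHat p ξ η) (k + 3) = h := by
  have h1 := floor_sHat (ξ := ξ) hp hη (k + 1)
  rw [digit, if_pos (sHat_lt_one hp hη hξ), h1]
  have : approx p ξ η h (k + 1)
      = h + p * (ξ * p ^ (k + 1) + ((h - η) * p ^ k + halfPow p k)) := by
    rw [approx, halfPow_succ hp]
    ring
  rw [this, Nat.add_mul_mod_self_left, Nat.mod_eq_of_lt (by omega)]

theorem prod_digit_sHat (hp : p = 2 * h + 1) (hη : η ≤ h) (hξ : ξ < p) (k : ℕ) :
    ∏ i ∈ Finset.Icc 1 (k + 2), ((digit p (sHat p ξ η) i : ℝ) + 1)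
      = (ξ + 1) * (h - η + 1) * (h + 1) ^ k := by
  induction k with
  | zero =>
    rw [Finset.prod_Icc_succ_top (by omega)]
    simp [digit_sHat_one hp hη hξ, digit_sHat_two hp hη hξ, Nat.cast_sub hη]
  | succ k ih =>
    rw [Finset.prod_Icc_succ_top (by omega), ih, digit_sHat_add_three hp hη hξ]
    ring

theorem phi_sHat (hp : p = 2 * h + 1) (hη : η ≤ h) (hξ : ξ < p) (h0 : 0 < h) :
    phi p (sHat p ξ η) = (ξ + 1) * (2 * ξ * p * (p + 1) + (p - 2 * η) * (p - 2 * η + 1)) /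
      (4 * p * (p + 1)) / A p := by
  have hA := A_pos (p := p) (by omega)
  have h2 : (p : ℝ) = 2 * h + 1 := by exact_mod_cast hp
  have hh : (0 : ℝ) < h := by exact_mod_cast h0
  have e : (A p : ℝ) = (h + 1) * p := by
    rw [A_cast, h2]
    ring
  have hp0 : (1 : ℝ) < p := by linarith
  set f : ℕ → ℝ := fun j => ((digit p (sHat p ξ η) (j + 1) : ℝ) / (A p : ℝ) ^ (j + 1)) *
    ∏ i ∈ Finset.Icc 1 (j + 1), ((digit p (sHat p ξ η) i : ℝ) + 1) with hf
  have hf0 : f 0 = ξ / A p * (ξ + 1) := by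
    simp [hf, digit_sHat_one hp hη hξ]
  have hf1 : f 1 = (h - η) / (A p : ℝ) ^ 2 * ((ξ + 1) * (h - η + 1)) := by
    have := prod_digit_sHat hp hη hξ 0
    rw [zero_add, pow_zero, mul_one] at this
    simp only [hf]
    rw [this, digit_sHat_two hp hη hξ, Nat.cast_sub hη]
  -- From the third digit on the terms are geometric with ratio `(h + 1)/A = 1/p`.
  have hfk : ∀ k, f (k + 2) = h * (ξ + 1) * (h - η + 1) / (p * (A p : ℝ) ^ 2) *
      ((p : ℝ)⁻¹) ^ k := by
    intro k
    have := prod_digit_sHat hp hη hξ (k + 1)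
    simp only [hf]
    rw [this, digit_sHat_add_three hp hη hξ, e]
    simp only [mul_pow, inv_pow]
    field_simp
    ring
  have hg : HasSum (fun k => f (k + 2))
      (h * (ξ + 1) * (h - η + 1) / (p * (A p : ℝ) ^ 2) * (1 - (p : ℝ)⁻¹)⁻¹) := by
    simp only [hfk]
    exact (hasSum_geometric_of_lt_one (by positivity) (inv_lt_one_of_one_lt₀ hp0)).mul_left _
  have hs := (hasSum_nat_add_iff 2).1 hg
  rw [phi, hs.tsum_eq, Finset.sum_range_succ, Finset.sum_range_one, hf0, hf1, A_cast]
  have h3 : 1 - (p : ℝ)⁻¹ = 2 * h / p := by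
    rw [h2]
    field_simp
    ring
  rw [h3]
  have h4 : (h : ℝ) = (p - 1) / 2 := by linarith
  rw [h4]
  have : (p : ℝ) - 1 ≠ 0 := by linarith
  field_simp
  ring

/-- Two applications of the digit recursion leave the tail `halfPow p k`, whose bound `A^k / 4` is
its share in `φ ŝ`. -/
theorem F_approx_le (hprime : p.Prime) (hp : p = 2 * h + 1) (hη : η ≤ h) (hξ : ξ < p)
    (h0 : 0 < h) (k : ℕ) :
    (F p (approx p ξ η h k) : ℝ) ≤ (A p : ℝ) ^ (k + 2) * phi p (sHat p ξ η) := by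
  have hlt := halfPow_lt hp k
  have hb : h - η < p := by omega
  have hle : (h - η) * p ^ k + halfPow p k ≤ p ^ (k + 1) := by
    have : (h - η + 1) * p ^ k ≤ p * p ^ k := Nat.mul_le_mul_right _ hb
    rw [pow_succ']
    nlinarith
  have hF := F_halfPow_le hprime hp k
  have hA := A_pos hprime.pos
  have hp0 : (0 : ℝ) < p := by exact_mod_cast hprime.pos
  have hηh : (η : ℝ) ≤ h := by exact_mod_cast hη
  rw [approx, F_mul_pow_add hprime hξ (k + 1) hle, F_mul_pow_add hprime hb k hlt.le,
    phi_sHat hp hη hξ h0, Nat.cast_sub hη]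
  have h1 : ((ξ : ℝ) + 1) * (ξ / 2 * (A p : ℝ) ^ (k + 1) +
      (h - η + 1) * ((h - η) / 2 * (A p : ℝ) ^ k + F p (halfPow p k))) ≤
      (ξ + 1) * (ξ / 2 * (A p : ℝ) ^ (k + 1) +
      (h - η + 1) * ((h - η) / 2 * (A p : ℝ) ^ k + (A p : ℝ) ^ k / 4)) := by
    have : (0 : ℝ) ≤ h - η + 1 := by linarith
    gcongr
  refine h1.trans_eq ?_
  have h2 : (p : ℝ) = 2 * h + 1 := by exact_mod_cast hp
  have h4 : (h : ℝ) = (p - 1) / 2 := by linarith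
  have h5 : (A p : ℝ) ^ (k + 2) = (A p : ℝ) ^ k * A p * A p := by ring
  rw [h4, h5, pow_succ]
  generalize (A p : ℝ) ^ k = X
  rw [A_cast]
  field_simp
  ring

/-- `A = p^ρ` turns `A^(-log_p s)` into `s^(-ρ)`. -/
theorem B_eq (hprime : p.Prime) (hp : p = 2 * h + 1) (hη : η ≤ h) :
    B p ξ η = sHat p ξ η ^ (-rho p) * phi p (sHat p ξ η) := by
  have hs := sHat_pos (ξ := ξ) hp hη
  have hp1 : (1 : ℝ) < p := by exact_mod_cast hprime.one_lt
  rw [B, G, ← rpow_rho hprime.two_le, ← Real.rpow_mul (by positivity)]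
  congr 1
  have : (p : ℝ) ^ (rho p * -Real.logb p (sHat p ξ η))
      = ((p : ℝ) ^ Real.logb p (sHat p ξ η)) ^ (-rho p) := by
    rw [← Real.rpow_mul (by positivity)]
    congr 1
    ring
  rw [this, Real.rpow_logb (by positivity) hp1.ne' hs]

theorem sHat_rpow (hprime : p.Prime) (hp : p = 2 * h + 1) (hη : η ≤ h) :
    sHat p ξ η ^ (-rho p) = A p * ((2 * (ξ : ℝ) + 1) / 2 - η / p) ^ (-rho p) := by
  have hp0 : (0 : ℝ) < p := by exact_mod_cast hprime.pos
  have e : (2 * (ξ : ℝ) + 1) / 2 - η / p = p * sHat p ξ η := by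
    rw [sHat]
    field_simp
  have hA := A_pos hprime.pos
  rw [e, Real.mul_rpow hp0.le (sHat_pos hp hη).le, Real.rpow_neg hp0.le, rpow_rho hprime.two_le]
  field_simp

theorem B_eq_explicit (hprime : p.Prime) (hp : p = 2 * h + 1) (hη : η ≤ h) (hξ : ξ < p)
    (h0 : 0 < h) (hξ0 : 0 < ξ) :
    B p ξ η = ((ξ + 1).choose 2 : ℝ) *
      (1 + ((p : ℝ) - 2 * η) * ((p : ℝ) - 2 * η + 1) / (2 * ξ * p * ((p : ℝ) + 1))) *
      ((2 * (ξ : ℝ) + 1) / 2 - (η : ℝ) / p) ^ (-rho p) := by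
  have hp0 : (0 : ℝ) < p := by exact_mod_cast hprime.pos
  have hξ' : (0 : ℝ) < ξ := by exact_mod_cast hξ0
  have hA := A_pos hprime.pos
  rw [B_eq hprime hp hη, sHat_rpow hprime hp hη, phi_sHat hp hη hξ h0, Nat.cast_choose_two]
  push_cast
  field_simp
  ring

open Filter Topology in
theorem exists_seq_le_B (hprime : p.Prime) (hp : p = 2 * h + 1) (hη : η ≤ h) (hξ : ξ < p)
    (h0 : 0 < h) (hξ0 : 0 < ξ) {x : ℝ} (hx : B p ξ η < x) :
    ∃ᶠ n : ℕ in atTop, (F p n : ℝ) / (n : ℝ) ^ rho p ≤ x := by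
  have hp1 : (1 : ℝ) < p := by exact_mod_cast hprime.one_lt
  have hs := sHat_pos (ξ := ξ) hp hη
  have hA := A_pos hprime.pos
  -- These are the numbers `approx p ξ η h k / p^(k+2)`.
  have hlim : Tendsto (fun k : ℕ => sHat p ξ η - 1 / 2 * ((p : ℝ)⁻¹) ^ (k + 2)) atTop
      (𝓝 (sHat p ξ η)) := by
    have h1 : Tendsto (fun k : ℕ => ((p : ℝ)⁻¹) ^ (k + 2)) atTop (𝓝 0) :=
      (tendsto_pow_atTop_nhds_zero_of_lt_one (by positivity)
        (inv_lt_one_of_one_lt₀ hp1)).comp (tendsto_add_atTop_nat 2)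
    have h2 := (h1.const_mul (1 / 2)).const_sub (sHat p ξ η)
    rwa [mul_zero, sub_zero] at h2
  have hlim2 := ((hlim.rpow_const (p := -rho p) (Or.inl hs.ne')).mul_const
    (phi p (sHat p ξ η)))
  rw [← B_eq hprime hp hη] at hlim2
  have happrox : Tendsto (approx p ξ η h) atTop atTop := by
    refine tendsto_atTop_mono (fun k => ?_) tendsto_id
    have h1 : k < p ^ k := Nat.lt_pow_self hprime.one_lt
    have h2 : p ^ k ≤ ξ * p ^ (k + 1) := by
      rw [pow_succ]
      exact (Nat.le_mul_of_pos_right _ hprime.pos).trans (Nat.le_mul_of_pos_left _ hξ0)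
    simp only [approx, id]
    omega
  refine happrox.frequently (Eventually.frequently ?_)
  filter_upwards [hlim2.eventually (gt_mem_nhds hx)] with k hk
  refine le_trans ?_ hk.le
  have happ := approx_cast (ξ := ξ) hp hη k
  have hpk : (0 : ℝ) < (p : ℝ) ^ (k + 2) := by positivity
  have e : (approx p ξ η h k : ℝ)
      = (p : ℝ) ^ (k + 2) * (sHat p ξ η - 1 / 2 * ((p : ℝ)⁻¹) ^ (k + 2)) := by
    rw [inv_pow, mul_sub]
    field_simp
    linarith
  have hn0 : (0 : ℝ) < approx p ξ η h k := by
    have : 0 < ξ * p ^ (k + 1) := Nat.mul_pos hξ0 (pow_pos hprime.pos _)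
    exact_mod_cast (by unfold approx; omega : 0 < approx p ξ η h k)
  have hy : 0 < sHat p ξ η - 1 / 2 * ((p : ℝ)⁻¹) ^ (k + 2) := by
    rw [e] at hn0
    exact pos_of_mul_pos_right hn0 hpk.le
  set y := sHat p ξ η - 1 / 2 * ((p : ℝ)⁻¹) ^ (k + 2)
  rw [e, Real.mul_rpow hpk.le hy.le, pow_rpow_rho hprime.two_le, Real.rpow_neg hy.le,
    div_le_iff₀ (by positivity)]
  refine (F_approx_le hprime hp hη hξ h0 k).trans_eq ?_
  have : 0 < y ^ rho p := by positivity
  field_simp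

end

/-! ### The value of the lower limit -/

open Filter in
theorem Certificate.Valid.beta_eq {c : Certificate} (hc : c.Valid) (h3 : 3 ≤ c.p) :
    beta c.p = B c.p c.ξ c.η := by
  obtain ⟨h, hh⟩ : Odd c.p := hc.prime.odd_of_ne_two (by omega)
  have hη : c.η ≤ h := by have := hc.η_lt; omega
  have h0 : 0 < h := by omega
  have hle : ∀ n : ℕ, 0 < n → B c.p c.ξ c.η ≤ F c.p n / (n : ℝ) ^ rho c.p := by
    intro n hn
    refine le_of_eq_of_le ?_ (Certificate.le_F hc hn)
    have hp0 : (0 : ℝ) < c.p := by exact_mod_cast hc.prime.pos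
    have hA := A_pos hc.prime.pos
    have hη2 : 2 * c.η ≤ c.p := hc.η_lt.le
    have e : (c.base : ℝ) / (2 * c.p) = (2 * (c.ξ : ℝ) + 1) / 2 - c.η / c.p := by
      rw [Certificate.base]
      push_cast [Nat.cast_sub hη2]
      field_simp
      ring
    rw [B_eq hc.prime hh hη, sHat_rpow hc.prime hh hη, phi_sHat hh hη hc.ξ_lt h0, e,
      Certificate.height]
    push_cast [Nat.cast_sub hη2]
    field_simp
  have hfreq := fun x (hx : B c.p c.ξ c.η < x) =>
    exists_seq_le_B hc.prime hh hη hc.ξ_lt h0 hc.ξ_pos hx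
  have hev : ∀ᶠ n : ℕ in atTop, B c.p c.ξ c.η ≤ F c.p n / (n : ℝ) ^ rho c.p :=
    (eventually_gt_atTop 0).mono hle
  -- The real `liminf` is meaningful only with bounds: `hev` bounds the quotients below, and `hfreq`
  -- supplies the coboundedness.
  refine le_antisymm (le_of_forall_gt_imp_ge_of_dense fun x hx => ?_) ?_
  · exact liminf_le_of_frequently_le (hfreq x hx) (isBoundedUnder_of_eventually_ge hev)
  · exact le_liminf_of_le
      (IsCoboundedUnder.of_frequently_le (hfreq (B c.p c.ξ c.η + 1) (by linarith))) hev

theorem beta_eq_B {p ξ η : ℕ} (hp : p.Prime) (h3 : 3 ≤ p) (h113 : p ≤ 113)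
    (h : (ξ, η) = xiEta p) :
    beta p = B p ξ η ∧ B p ξ η = ((ξ + 1).choose 2 : ℝ) *
      (1 + ((p : ℝ) - 2 * η) * ((p : ℝ) - 2 * η + 1) / (2 * ξ * p * ((p : ℝ) + 1))) *
      ((2 * (ξ : ℝ) + 1) / 2 - (η : ℝ) / p) ^ (-rho p) := by
  obtain ⟨c, hc, rfl, hxe⟩ := exists_certificate hp h3 h113
  rw [← hxe, Prod.mk.injEq] at h
  obtain ⟨rfl, rfl⟩ := h
  have hv := Certificate.valid_of_check hp (check_certificates c hc)
  obtain ⟨h, hh⟩ : Odd c.p := hp.odd_of_ne_two (by omega)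
  exact ⟨hv.beta_eq h3,
    B_eq_explicit hp hh (by have := hv.η_lt; omega) hv.ξ_lt (by omega) hv.ξ_pos⟩

theorem beta_eq_of_xiEta_eq_one_zero {p : ℕ} (hp : p.Prime) (h3 : 3 ≤ p) (h113 : p ≤ 113)
    (h : (1, 0) = xiEta p) : beta p = (3 / 2 : ℝ) ^ (1 - rho p) := by
  obtain ⟨h1, h2⟩ := beta_eq_B hp h3 h113 h
  have hp0 : (0 : ℝ) < p := by exact_mod_cast hp.pos
  have e : (3 / 2 : ℝ) ^ (1 - rho p) = 3 / 2 * (3 / 2) ^ (-rho p) := by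
    rw [sub_eq_add_neg, Real.rpow_add (by norm_num), Real.rpow_one]
  -- For `(ξ, η) = (1, 0)` the middle factor is `1 + p (p + 1) / (2 p (p + 1)) = 3/2`.
  rw [h1, h2, e]
  norm_num
  left
  field_simp
  norm_num

end PascalModPrime

theorem theorem1 :
    (PascalModPrime.beta 3 = (3 / 2 : ℝ) ^ (1 - PascalModPrime.rho 3) ∧
      PascalModPrime.beta 5 = (3 / 2 : ℝ) ^ (1 - PascalModPrime.rho 5) ∧
      PascalModPrime.beta 7 = (3 / 2 : ℝ) ^ (1 - PascalModPrime.rho 7) ∧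
      PascalModPrime.beta 11 = (59 / 44 : ℝ) * (22 / 31 : ℝ) ^ PascalModPrime.rho 11) ∧
    ∀ p : ℕ, p.Prime → 3 ≤ p → p ≤ 113 → ∀ ξ η : ℕ, (ξ, η) = PascalModPrime.xiEta p →
      PascalModPrime.beta p = PascalModPrime.B p ξ η ∧
      PascalModPrime.B p ξ η =
        ((ξ + 1).choose 2 : ℝ) *
          (1 + ((p : ℝ) - 2 * η) * ((p : ℝ) - 2 * η + 1) / (2 * ξ * p * ((p : ℝ) + 1))) *
          ((2 * (ξ : ℝ) + 1) / 2 - (η : ℝ) / p) ^ (-PascalModPrime.rho p) := by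
  refine ⟨⟨?_, ?_, ?_, ?_⟩, fun p hp h3 h113 ξ η h => PascalModPrime.beta_eq_B hp h3 h113 h⟩
  · exact PascalModPrime.beta_eq_of_xiEta_eq_one_zero (by norm_num) (by norm_num) (by norm_num)
      (by decide)
  · exact PascalModPrime.beta_eq_of_xiEta_eq_one_zero (by norm_num) (by norm_num) (by norm_num)
      (by decide)
  · exact PascalModPrime.beta_eq_of_xiEta_eq_one_zero (by norm_num) (by norm_num) (by norm_num)
      (by decide)
  · obtain ⟨h1, h2⟩ := PascalModPrime.beta_eq_B (p := 11) (ξ := 1) (η := 1) (by norm_num)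
      (by norm_num) (by norm_num) (by decide)
    rw [h1, h2, Real.rpow_neg (by norm_num), ← Real.inv_rpow (by norm_num)]
    norm_num
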